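/- Let $\alpha>0$ be real. The initial value problem $F'(x)=1-F(x)^\alpha$ for $x\ge 0$, $F(0)=0$, has a unique solution $F_\alpha$ on $[0,\infty)$. Put $$\phi_\alpha(t):=1-F_\alpha\left(-\tfrac1\alpha\ln t\right),\qquad t\in(0,1].$$ Define $$\gamma_\alpha:=\frac1\alpha\exp\left(-\int_0^1\frac{1-x^{(1-\alpha)/\alpha}}{1-x}\,dx\right),$$ where the integral converges absolutely, and define real numbers $\sigma_k$, $k\ge1$ (depending on $\alpha$), by $$\sigma_1:=1,\qquad \sigma_k:=\frac{1}{k(k-1)}\sum_{\nu=1}^{k-1}\sigma_\nu\,\sigma_{k-\nu}\,\bigl[(1+\alpha)\nu-\alpha k\bigr]\,\nu\qquad(k\ge2).$$ Then the following hold. (i) There is $\varepsilon>0$, depending on $\alpha$, such that the restriction of $\phi_\alpha$ to $(0,1)$ extends to a real analytic function on $(-\varepsilon,1)$. Such an extension is unique for each $\varepsilon$, and is again denoted by $\phi_\alpha$. (ii) The Taylor series of $\phi_\alpha$ at $0$ is $\sum_{k\ge1}\sigma_k\gamma_\alpha^k t^k$; that is, for all $t$ in some neighbourhood of $0$, $$\phi_\alpha(t)=\sum_{k=1}^\infty\sigma_k(\gamma_\alpha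 t)^k .$$ (iii) If $0<\alpha<1$, then $\sigma_k>0$ for all $k\ge1$, the series in (ii) converges for every $t\in(-1,1)$, and its sum is $\phi_\alpha(t)$ at every $t\in(-1,1)$ to which $\phi_\alpha$ has been continued as in (i). (iv) If $0<\alpha<1$, then $\phi_\alpha$ extends to a real analytic function on $(-\infty,1)$, and this extension is strictly increasing and convex on $(-\infty,1)$. -/

import Mathlib

open Set

/-- `F` solves the initial value problem `F' = 1 - F ^ α`, `F 0 = 0` on `[0, ∞)`
(one-sided derivative at `0`). Values of `F` at negative arguments play no role. -/
def IsProfile (α : ℝ) (F : ℝ → ℝ) : Prop :=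
  F 0 = 0 ∧ ∀ x, 0 ≤ x → HasDerivWithinAt F (1 - F x ^ α) (Ici 0) x

/-- `φ(t) = 1 - F(-(1/α) ln t)`; meaningful for `t ∈ (0, 1]` only. -/
noncomputable def profilePhi (α : ℝ) (F : ℝ → ℝ) (t : ℝ) : ℝ :=
  1 - F (-(1 / α) * Real.log t)

/-- `g` is a real analytic continuation to the open set `U` of the function `f` on `(0, 1)`.
No condition is put on the values of `f` outside `(0, 1)` or on those of `g` outside `U`. -/
def IsAnalyticContinuation (f : ℝ → ℝ) (U : Set ℝ) (g : ℝ → ℝ) : Prop :=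
  Ioo 0 1 ⊆ U ∧ AnalyticOnNhd ℝ g U ∧ EqOn g f (Ioo 0 1)

/-- The integrand `(1 - x ^ ((1 - α) / α)) / (1 - x)`. -/
noncomputable def gammaIntegrand (α : ℝ) (x : ℝ) : ℝ :=
  (1 - x ^ ((1 - α) / α)) / (1 - x)

/-- The constant `γ_α`. -/
noncomputable def profileGamma (α : ℝ) : ℝ :=
  1 / α * Real.exp (-∫ x in (0 : ℝ)..1, gammaIntegrand α x)

/-- The coefficients `σ_k`, `k ≥ 1` (the value at `k = 0` is a convention). The recurrence is
written with `k = n + 2` and summation index `ν - 1`; see `profileSigma_rec` for the usual form. -/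
noncomputable def profileSigma (α : ℝ) : ℕ → ℝ
  | 0 => 0
  | 1 => 1
  | n + 2 => 1 / (((n : ℝ) + 2) * ((n : ℝ) + 1)) *
      ∑ ν : Fin (n + 1), profileSigma α (ν + 1) * profileSigma α (n + 1 - ν) *
        ((1 + α) * ((ν : ℝ) + 1) - α * ((n : ℝ) + 2)) * ((ν : ℝ) + 1)

theorem profileSigma_one (α : ℝ) : profileSigma α 1 = 1 := by
  simp [profileSigma]

theorem profileSigma_rec (α : ℝ) (k : ℕ) (hk : 2 ≤ k) :
    profileSigma α k = 1 / ((k : ℝ) * ((k : ℝ) - 1)) *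
      ∑ ν ∈ Finset.Icc 1 (k - 1), profileSigma α ν * profileSigma α (k - ν) *
        ((1 + α) * (ν : ℝ) - α * (k : ℝ)) * (ν : ℝ) := by
  obtain ⟨n, rfl⟩ := Nat.exists_eq_add_of_le' hk
  have hI : Finset.Icc 1 (n + 2 - 1) = Finset.Ico 1 (n + 2) := by
    ext x
    simp only [Finset.mem_Icc, Finset.mem_Ico]
    omega
  rw [hI, Finset.sum_Ico_eq_sum_range, profileSigma, ← Fin.sum_univ_eq_sum_range
    (fun i => profileSigma α (1 + i) * profileSigma α (n + 2 - (1 + i)) *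
        ((1 + α) * ((1 + i : ℕ) : ℝ) - α * ((n + 2 : ℕ) : ℝ)) * ((1 + i : ℕ) : ℝ))]
  congr 1
  · push_cast
    congr 2
    ring
  · refine Finset.sum_congr rfl fun ν _ => ?_
    have h1 : n + 2 - (1 + (ν : ℕ)) = n + 1 - ν := by omega
    rw [h1, add_comm 1 (ν : ℕ)]
    push_cast
    ring

/-!
The equation `F' = 1 - F ^ α` becomes `α t φ' = 1 - (1 - φ) ^ α`, which is solved through the
inverse function `S` of `φ`. Put `p = (1 - α) / α` and
`D(u) = exp (∫ x in 0..u ^ α, (1 - x ^ p) / (1 - x))`; then `S(y) = (1 - (1 - y) ^ α) D(1 - y)`,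
normalised by `S 1 = 1`, has derivative `α D(1 - y)`. This is positive and analytic for `y < 1`,
also across `y = 0`, so `φ = S⁻¹` is analytic on the interval `S (-∞, 1) ∋ 0`, and
`φ'(0) = 1 / S'(0) = γ`.

Differentiating the first-order equation and using it once more to eliminate the power gives
`t φ'' = (t φ')' φ - α t φ'²`, whose coefficients obey the recurrence of the `σ_k`. For `α < 1`,
averaging the summands of indices `ν` and `k - ν` makes the recurrence manifestly positive. Moreover
`D` is then nondecreasing, so that `φ` is convex and `S (-∞, 1) = (-∞, 1)`. Since all derivatives
at `0` are nonnegative, Bernstein's theorem makes the Taylor series converge on `(-1, 1)`.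
-/

open Filter Function MeasureTheory PowerSeries Topology
open Finset.HasAntidiagonal (antidiagonal)
open scoped ContDiff ENNReal Nat

section Primitive

variable {𝕜 E : Type*} [RCLike 𝕜] [NormedAddCommGroup E] [NormedSpace 𝕜 E]

/-- The term-by-term primitive, with constant term `c`, of a power series in one variable. -/
noncomputable def primitiveSeries (p : FormalMultilinearSeries 𝕜 𝕜 E) (c : E) :
    FormalMultilinearSeries 𝕜 𝕜 E
  | 0 => ContinuousMultilinearMap.mkPiRing 𝕜 (Fin 0) c
  | n + 1 => ContinuousMultilinearMap.mkPiRing 𝕜 (Fin (n + 1)) ((n + 1 : 𝕜)⁻¹ • p.coeff n)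

theorem radius_le_radius_primitiveSeries (p : FormalMultilinearSeries 𝕜 𝕜 E) (c : E) :
    p.radius ≤ (primitiveSeries p c).radius := by
  refine ENNReal.le_of_forall_nnreal_lt fun r hr => ?_
  obtain ⟨C, -, hp⟩ := p.norm_mul_pow_le_of_lt_radius hr
  refine FormalMultilinearSeries.le_radius_of_bound _ (max ‖c‖ (C * r)) fun n => ?_
  rcases n with _ | n
  · simp [primitiveSeries]
  · refine le_max_of_le_right ?_
    have hinv : ‖(n + 1 : 𝕜)⁻¹‖ ≤ 1 := by
      rw [norm_inv, ← Nat.cast_add_one, RCLike.norm_natCast]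
      exact inv_le_one_of_one_le₀ (by simp)
    calc ‖primitiveSeries p c (n + 1)‖ * (r : ℝ) ^ (n + 1)
        = ‖(n + 1 : 𝕜)⁻¹‖ * (‖p n‖ * (r : ℝ) ^ n) * r := by
          rw [primitiveSeries, ContinuousMultilinearMap.norm_mkPiRing, norm_smul, pow_succ,
            FormalMultilinearSeries.norm_apply_eq_norm_coef]
          ring
      _ ≤ 1 * C * r := by gcongr; exact hp n
      _ = C * r := by rw [one_mul]

variable [CompleteSpace E] {p : FormalMultilinearSeries 𝕜 𝕜 E} {f : 𝕜 → E} {x : 𝕜} {r : ℝ≥0∞}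

theorem hasFPowerSeriesOnBall_primitiveSeries_sum (hr : 0 < r) (hp : r ≤ p.radius) (c : E) :
    HasFPowerSeriesOnBall (fun z => (primitiveSeries p c).sum (z - x))
      (primitiveSeries p c) x r := by
  have hrad := hp.trans (radius_le_radius_primitiveSeries p c)
  simpa using (((primitiveSeries p c).hasFPowerSeriesOnBall
    (hr.trans_le hrad)).mono hr hrad).comp_sub x

theorem hasDerivAt_primitiveSeries_sum (hf : HasFPowerSeriesOnBall f p x r) (c : E) {y : 𝕜}
    (hy : y ∈ Metric.eball x r) :
    HasDerivAt (fun z => (primitiveSeries p c).sum (z - x)) (f y) y := by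
  have hq := hasFPowerSeriesOnBall_primitiveSeries_sum (x := x) hf.r_pos hf.r_le c
  refine (hq.analyticAt_of_mem hy).differentiableAt.hasDerivAt.congr_deriv ?_
  rcases eq_or_ne y x with rfl | hne
  · have hcoeff : p.coeff 0 = f y := hf.coeff_zero 1
    rw [hq.hasFPowerSeriesAt.deriv, primitiveSeries, ContinuousMultilinearMap.mkPiRing_apply,
      hcoeff]
    simp
  · have hyx : y - x ∈ Metric.eball 0 r := by
      simpa [edist_eq_enorm_sub] using hy
    have hg := (hq.fderiv.hasSum hyx).mapL (ContinuousLinearMap.apply 𝕜 E (y - x))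
    have hfs := (hf.hasSum hyx).const_smul (y - x)
    rw [add_sub_cancel] at hg hfs
    have hterm : ∀ n, (primitiveSeries p c).derivSeries n (fun _ => y - x) (y - x) =
        (y - x) • p n fun _ => y - x := fun n => by
      have hn : (n + 1 : 𝕜) ≠ 0 := n.cast_add_one_ne_zero
      rw [FormalMultilinearSeries.derivSeries_apply_diag, primitiveSeries,
        ContinuousMultilinearMap.mkPiRing_apply, FormalMultilinearSeries.apply_eq_pow_smul_coeff]
      simp only [Finset.prod_const, Finset.card_univ, Fintype.card_fin, pow_succ, smul_smul,
        ← Nat.cast_smul_eq_nsmul 𝕜, Nat.cast_add, Nat.cast_one]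
      field_simp
    simp only [ContinuousLinearMap.apply_apply, hterm] at hg
    have hderiv := hg.unique hfs
    rw [fderiv_eq_smul_deriv] at hderiv
    exact smul_right_injective E (sub_ne_zero.2 hne) hderiv

theorem analyticAt_of_hasDerivAt {F : 𝕜 → E} (hF : ∀ᶠ y in 𝓝 x, HasDerivAt F (f y) y)
    (hf : AnalyticAt 𝕜 f x) : AnalyticAt 𝕜 F x := by
  obtain ⟨p, r, hp⟩ := hf
  obtain ⟨ε, hε, hball⟩ := Metric.nhds_basis_eball.mem_iff.1
    (inter_mem (Metric.eball_mem_nhds x hp.r_pos) hF)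
  set G := fun z => (primitiveSeries p (F x)).sum (z - x)
  have hGp : HasFPowerSeriesOnBall G (primitiveSeries p (F x)) x r :=
    hasFPowerSeriesOnBall_primitiveSeries_sum hp.r_pos hp.r_le (F x)
  have hG : ∀ y ∈ Metric.eball x ε, HasDerivAt G (f y) y := fun y hy =>
    hasDerivAt_primitiveSeries_sum hp (F x) (hball hy).1
  have hGx : G x = F x := by
    rw [← hGp.coeff_zero 1, primitiveSeries, ContinuousMultilinearMap.mkPiRing_apply]
    simp
  have hGF : EqOn G F (Metric.eball x ε) :=
    Metric.isOpen_eball.eqOn_of_deriv_eq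
      (letI := NormedSpace.restrictScalars ℝ 𝕜 𝕜; Metric.isPreconnected_eball)
      (fun y hy => (hG y hy).differentiableAt.differentiableWithinAt)
      (fun y hy => (hball hy).2.differentiableAt.differentiableWithinAt)
      (fun y hy => (hG y hy).deriv.trans (hball hy).2.deriv.symm) (Metric.mem_eball_self hε) hGx
  exact hGp.analyticAt.congr (hGF.eventuallyEq_of_mem (Metric.eball_mem_nhds x hε))

end Primitive

section AbsolutelyMonotone

theorem exists_hasFPowerSeriesOnBall_iteratedDeriv {𝕜 E : Type*} [NontriviallyNormedField 𝕜]
    [NormedAddCommGroup E] [NormedSpace 𝕜 E] [CompleteSpace E] {f : 𝕜 → E} {x : 𝕜}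
    {p : FormalMultilinearSeries 𝕜 𝕜 E} {r : ℝ≥0∞} (hf : HasFPowerSeriesOnBall f p x r) (n : ℕ) :
    ∃ q : FormalMultilinearSeries 𝕜 𝕜 E, HasFPowerSeriesOnBall (iteratedDeriv n f) q x r := by
  induction n with
  | zero => exact ⟨p, by rwa [iteratedDeriv_zero]⟩
  | succ n ih =>
    obtain ⟨q, hq⟩ := ih
    rw [iteratedDeriv_succ]
    exact ⟨_, (ContinuousLinearMap.apply 𝕜 E (1 : 𝕜)).comp_hasFPowerSeriesOnBall hq.fderiv⟩

variable {f : ℝ → ℝ} {x y : ℝ}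

theorem eventually_iteratedDeriv_nonneg (hf : AnalyticAt ℝ f x)
    (h : ∀ n, 0 ≤ iteratedDeriv n f x) : ∀ᶠ y in 𝓝[>] x, ∀ n, 0 ≤ iteratedDeriv n f y := by
  obtain ⟨p, r, hp⟩ := hf
  filter_upwards [self_mem_nhdsWithin, nhdsWithin_le_nhds (Metric.eball_mem_nhds x hp.r_pos)]
    with y hxy hyr n
  obtain ⟨q, hq⟩ := exists_hasFPowerSeriesOnBall_iteratedDeriv hp n
  have hsum := hq.hasSum (y := y - x) (by simpa [edist_eq_enorm_sub] using hyr)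
  rw [hq.hasFPowerSeriesAt.eq_formalMultilinearSeries hq.analyticAt.hasFPowerSeriesAt,
    add_sub_cancel] at hsum
  refine hsum.nonneg fun m => ?_
  have hmn := h (m + n)
  rw [iteratedDeriv_eq_iterate, iterate_add_apply, ← iteratedDeriv_eq_iterate,
    ← iteratedDeriv_eq_iterate] at hmn
  rw [FormalMultilinearSeries.apply_eq_pow_smul_coeff, FormalMultilinearSeries.coeff_ofScalars]
  have hyx : 0 ≤ y - x := sub_nonneg.2 (mem_Ioi.1 hxy).le
  positivity

theorem iteratedDeriv_nonneg_of_left (hf : AnalyticOnNhd ℝ f (Icc x y))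
    (h : ∀ n, 0 ≤ iteratedDeriv n f x) {t : ℝ} (ht : t ∈ Icc x y) (n : ℕ) :
    0 ≤ iteratedDeriv n f t := by
  have hcont : ∀ n, ContinuousOn (iteratedDeriv n f) (Icc x y) := fun n => by
    rw [iteratedDeriv_eq_iterate]
    exact (hf.iterated_deriv n).continuousOn
  have hclosed : IsClosed ({s | ∀ n, 0 ≤ iteratedDeriv n f s} ∩ Icc x y) := by
    have : {s | ∀ n, 0 ≤ iteratedDeriv n f s} ∩ Icc x y =
        ⋂ n, Icc x y ∩ iteratedDeriv n f ⁻¹' Ici 0 := by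
      rw [← inter_iInter, inter_comm]
      congr 1
      ext
      simp
    rw [this]
    exact isClosed_iInter fun n => (hcont n).preimage_isClosed_of_isClosed isClosed_Icc isClosed_Ici
  exact hclosed.Icc_subset_of_forall_mem_nhdsWithin h
    (fun s hs => eventually_iteratedDeriv_nonneg (hf s (Ico_subset_Icc_self hs.2)) hs.1) ht n

theorem sum_iteratedDeriv_le (hxy : x ≤ y) (hf : AnalyticOnNhd ℝ f (Icc x y))
    (h : ∀ n, 0 ≤ iteratedDeriv n f x) (n : ℕ) :
    ∑ k ∈ Finset.range n, iteratedDeriv k f x / k ! * (y - x) ^ k ≤ f y := by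
  rcases n with _ | n
  · simpa using iteratedDeriv_nonneg_of_left hf h (right_mem_Icc.2 hxy) 0
  rcases hxy.eq_or_lt with rfl | hxy
  · simp [Finset.sum_range_succ']
  have hIcc : uIcc x y = Icc x y := uIcc_of_le hxy.le
  obtain ⟨ξ, hξ, heq⟩ := taylor_mean_remainder_lagrange_iteratedDeriv (n := n) hxy.ne
    (hIcc ▸ hf.contDiffOn (uniqueDiffOn_Icc hxy))
  have hpoly : taylorWithinEval f n (uIcc x y) x y =
      ∑ k ∈ Finset.range (n + 1), iteratedDeriv k f x / k ! * (y - x) ^ k := by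
    have hx : x ∈ Icc x y := left_mem_Icc.2 hxy.le
    rw [hIcc, taylor_within_apply]
    refine Finset.sum_congr rfl fun k _ => ?_
    rw [iteratedDerivWithin_eq_iteratedDeriv (uniqueDiffOn_Icc hxy) (hf x hx).contDiffAt hx,
      smul_eq_mul]
    ring
  have hξ' : ξ ∈ Icc x y := by
    rw [uIoo_of_lt hxy] at hξ
    exact Ioo_subset_Icc_self hξ
  have hrem := iteratedDeriv_nonneg_of_left hf h hξ' (n + 1)
  rw [← hpoly, ← sub_nonneg, heq]
  have := sub_pos.2 hxy
  positivity

/-- Bernstein's theorem on absolutely monotone functions. -/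
theorem hasFPowerSeriesOnBall_of_iteratedDeriv_nonneg {r : ℝ} (hr : 0 < r)
    (hf : AnalyticOnNhd ℝ f (Metric.ball x r)) (h : ∀ n, 0 ≤ iteratedDeriv n f x) :
    HasFPowerSeriesOnBall f
      (FormalMultilinearSeries.ofScalars ℝ fun n => iteratedDeriv n f x / n !) x
      (ENNReal.ofReal r) := by
  refine AnalyticOn.hasFPowerSeriesOnSubball (ENNReal.ofReal_pos.2 hr)
    (Metric.eball_ofReal (x := x) ▸ hf.analyticOn) ?_
  refine ENNReal.le_of_forall_nnreal_lt fun s hs =>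
    FormalMultilinearSeries.le_radius_of_summable _ ?_
  have hsr : s < r := (ENNReal.ofReal_lt_ofReal_iff hr).1 (by simpa using hs)
  have hsub : Icc x (x + s) ⊆ Metric.ball x r := by
    rw [Real.ball_eq_Ioo]
    exact fun t ht => ⟨by linarith [ht.1], by linarith [ht.2]⟩
  refine summable_of_sum_range_le (c := f (x + s)) (fun n => by positivity) fun n => ?_
  simpa [abs_of_nonneg (h _)] using
    sum_iteratedDeriv_le (le_add_of_nonneg_right s.2) (hf.mono hsub) h n

end AbsolutelyMonotone

section TaylorSeries

variable {𝕜 : Type*} [NontriviallyNormedField 𝕜] {f g : 𝕜 → 𝕜} {x : 𝕜}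

/-- The Taylor series of `f` at `x`, as a formal power series. -/
noncomputable def taylorSeries (f : 𝕜 → 𝕜) (x : 𝕜) : 𝕜⟦X⟧ :=
  PowerSeries.mk fun n => iteratedDeriv n f x / n !

theorem coeff_taylorSeries (n : ℕ) : coeff n (taylorSeries f x) = iteratedDeriv n f x / n ! :=
  coeff_mk _ _

theorem taylorSeries_congr (h : f =ᶠ[𝓝 x] g) : taylorSeries f x = taylorSeries g x := by
  simp only [taylorSeries, h.iteratedDeriv_eq]

theorem taylorSeries_sub (hf : ContDiffAt 𝕜 ∞ f x) (hg : ContDiffAt 𝕜 ∞ g x) :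
    taylorSeries (fun y => f y - g y) x = taylorSeries f x - taylorSeries g x := by
  ext n
  rw [map_sub, coeff_taylorSeries, coeff_taylorSeries, coeff_taylorSeries, iteratedDeriv_fun_sub
    (hf.of_le (by exact_mod_cast le_top)) (hg.of_le (by exact_mod_cast le_top)), sub_div]

theorem taylorSeries_const_mul (c : 𝕜) :
    taylorSeries (fun y => c * f y) x = C c * taylorSeries f x := by
  ext n
  rw [coeff_C_mul, coeff_taylorSeries, coeff_taylorSeries, iteratedDeriv_const_mul_field,
    mul_div_assoc]

theorem taylorSeries_id : taylorSeries (fun y : 𝕜 => y) 0 = X := by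
  ext n
  rw [coeff_taylorSeries, iteratedDeriv_fun_id, coeff_X]
  split_ifs <;> simp_all

variable [CharZero 𝕜]

theorem taylorSeries_mul (hf : ContDiffAt 𝕜 ∞ f x) (hg : ContDiffAt 𝕜 ∞ g x) :
    taylorSeries (fun y => f y * g y) x = taylorSeries f x * taylorSeries g x := by
  ext n
  rw [coeff_mul, coeff_taylorSeries, iteratedDeriv_fun_mul
    (hf.of_le (by exact_mod_cast le_top)) (hg.of_le (by exact_mod_cast le_top)), Finset.sum_div,
    Finset.Nat.sum_antidiagonal_eq_sum_range_succ
      fun i j => coeff i (taylorSeries f x) * coeff j (taylorSeries g x)]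
  refine Finset.sum_congr rfl fun i hi => ?_
  have hn : (n ! : 𝕜) ≠ 0 := Nat.cast_ne_zero.2 n.factorial_ne_zero
  rw [Nat.cast_choose 𝕜 (Finset.mem_range_succ_iff.1 hi), coeff_taylorSeries, coeff_taylorSeries]
  field_simp

theorem taylorSeries_deriv : taylorSeries (deriv f) x = d⁄dX 𝕜 (taylorSeries f x) := by
  ext n
  have hn : (n + 1 : 𝕜) ≠ 0 := n.cast_add_one_ne_zero
  rw [coeff_derivative, coeff_taylorSeries, coeff_taylorSeries, iteratedDeriv_succ',
    Nat.factorial_succ, Nat.cast_mul, Nat.cast_add_one]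
  field_simp

end TaylorSeries

section Recurrence

theorem profileSigma_add_two (α : ℝ) (n : ℕ) :
    profileSigma α (n + 2) = 1 / (((n : ℝ) + 2) * ((n : ℝ) + 1)) *
      ∑ ij ∈ antidiagonal n, profileSigma α (ij.1 + 1) * profileSigma α (ij.2 + 1) *
        ((ij.1 + 1 : ℝ) - α * (ij.2 + 1)) * (ij.1 + 1) := by
  rw [profileSigma, Finset.Nat.sum_antidiagonal_eq_sum_range_succ
    (fun i j => profileSigma α (i + 1) * profileSigma α (j + 1) *
      ((i + 1 : ℝ) - α * (j + 1)) * (i + 1)), Finset.sum_range]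
  congr 1
  refine Finset.sum_congr rfl fun ν _ => ?_
  have hν : (ν : ℕ) ≤ n := Nat.lt_succ_iff.1 ν.2
  rw [Nat.sub_add_comm hν, Nat.cast_sub hν]
  ring

theorem profileSigma_pos {α : ℝ} (hα : 0 ≤ α) (hα1 : α < 1) {k : ℕ} (hk : 1 ≤ k) :
    0 < profileSigma α k := by
  induction k using Nat.strong_induction_on with
  | _ k ih =>
    match k with
    | 1 => simp only [profileSigma_one, one_pos]
    | n + 2 =>
      rw [profileSigma_add_two]
      set S : ℕ × ℕ → ℝ := fun ij => profileSigma α (ij.1 + 1) * profileSigma α (ij.2 + 1) *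
        ((ij.1 + 1 : ℝ) - α * (ij.2 + 1)) * (ij.1 + 1)
      have hswap : ∑ ij ∈ antidiagonal n, S ij.swap = ∑ ij ∈ antidiagonal n, S ij :=
        Finset.Nat.sum_antidiagonal_swap
      have hpos : 0 < ∑ ij ∈ antidiagonal n, (S ij + S ij.swap) := by
        refine Finset.sum_pos (fun ⟨i, j⟩ hij => ?_) ⟨(0, n), by simp⟩
        rw [Finset.HasAntidiagonal.mem_antidiagonal] at hij
        have hi := ih (i + 1) (by omega) (by omega)
        have hj := ih (j + 1) (by omega) (by omega)
        have hsym : S (i, j) + S (j, i) = profileSigma α (i + 1) * profileSigma α (j + 1) *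
            ((1 - α) * (((i : ℝ) + 1) ^ 2 + ((j : ℝ) + 1) ^ 2) + α * ((i : ℝ) - j) ^ 2) := by
          simp only [S]
          ring
        rw [Prod.swap_prod_mk, hsym]
        have := sub_pos.2 hα1
        positivity
      rw [Finset.sum_add_distrib, hswap, ← two_mul] at hpos
      exact mul_pos (by positivity) (pos_of_mul_pos_right hpos zero_le_two)

theorem profileSigma_nonneg {α : ℝ} (hα : 0 ≤ α) (hα1 : α < 1) (k : ℕ) : 0 ≤ profileSigma α k := by
  rcases k.eq_zero_or_pos with rfl | hk
  · rw [profileSigma]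
  · exact (profileSigma_pos hα hα1 hk).le

theorem coeff_add_two_mul {R : Type*} [CommRing R] {α : R} {p : R⟦X⟧} (h0 : constantCoeff p = 0)
    (hp : X * d⁄dX R (d⁄dX R p) =
      d⁄dX R (X * d⁄dX R p) * p - C α * (X * (d⁄dX R p * d⁄dX R p))) (n : ℕ) :
    coeff (n + 2) p * ((n + 2) * (n + 1)) =
      ∑ ij ∈ antidiagonal n, coeff (ij.1 + 1) p * coeff (ij.2 + 1) p *
        ((ij.1 + 1 : R) - α * (ij.2 + 1)) * (ij.1 + 1) := by
  have hcoeff := congrArg (coeff (n + 1)) hp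
  rw [map_sub, coeff_C_mul, coeff_succ_X_mul, coeff_succ_X_mul, coeff_mul, coeff_mul,
    Finset.Nat.sum_antidiagonal_succ', coeff_zero_eq_constantCoeff_apply, h0, mul_zero, zero_add,
    Finset.mul_sum, ← Finset.sum_sub_distrib] at hcoeff
  simp only [coeff_derivative, coeff_succ_X_mul, Nat.cast_add_one] at hcoeff
  calc coeff (n + 2) p * ((n + 2) * (n + 1))
      = coeff (n + 1 + 1) p * (n + 1 + 1) * (n + 1) := by ring
    _ = _ := by
      rw [hcoeff]
      exact Finset.sum_congr rfl fun ij _ => by ring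

theorem coeff_eq_profileSigma_mul_pow {α : ℝ} {p : ℝ⟦X⟧} (h0 : constantCoeff p = 0)
    (hp : X * d⁄dX ℝ (d⁄dX ℝ p) =
      d⁄dX ℝ (X * d⁄dX ℝ p) * p - C α * (X * (d⁄dX ℝ p * d⁄dX ℝ p))) (k : ℕ) :
    coeff k p = profileSigma α k * coeff 1 p ^ k := by
  induction k using Nat.strong_induction_on with
  | _ k ih =>
    match k with
    | 0 => rw [coeff_zero_eq_constantCoeff_apply, h0, profileSigma, zero_mul]
    | 1 => rw [profileSigma_one, one_mul, pow_one]
    | n + 2 =>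
      rw [profileSigma_add_two, one_div_mul_eq_div, div_mul_eq_mul_div, eq_div_iff (by positivity),
        coeff_add_two_mul h0 hp, Finset.sum_mul]
      refine Finset.sum_congr rfl fun ⟨i, j⟩ hij => ?_
      rw [Finset.HasAntidiagonal.mem_antidiagonal] at hij
      rw [ih (i + 1) (by omega), ih (j + 1) (by omega), ← hij]
      ring

end Recurrence

section FirstOrderEquation

variable {α : ℝ} {f : ℝ → ℝ} {t : ℝ}

theorem mul_deriv_deriv_of_first_order (hα : α ≠ 0) (hf : AnalyticAt ℝ f t) (hft : f t < 1)
    (h : ∀ᶠ s in 𝓝 t, α * (s * deriv f s) = 1 - (1 - f s) ^ α) :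
    t * deriv (deriv f) t =
      deriv (fun s => s * deriv f s) t * f t - α * (t * (deriv f t * deriv f t)) := by
  have hu : 0 < 1 - f t := sub_pos.2 hft
  have h_mul : HasDerivAt (fun s => s * deriv f s) (1 * deriv f t + t * deriv (deriv f) t) t :=
    (hasDerivAt_id' t).fun_mul hf.deriv.differentiableAt.hasDerivAt
  have h_rpow := ((hf.differentiableAt.hasDerivAt.const_sub 1).rpow_const (p := α)
    (Or.inl hu.ne')).const_sub 1
  have h_deriv := ((h_mul.const_mul α).congr_of_eventuallyEq (EventuallyEq.symm h)).unique h_rpow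
  have h_pow : (1 - f t) * (1 - f t) ^ (α - 1) = (1 - f t) ^ α := by
    rw [← Real.rpow_one_add' hu.le (by simpa using hα), add_sub_cancel]
  rw [h_mul.deriv]
  refine mul_left_cancel₀ hα ?_
  linear_combination (1 - f t) * h_deriv + α * deriv f t * h_pow + α * deriv f t * h.self_of_nhds

theorem coeff_taylorSeries_of_first_order (hα : α ≠ 0) (hf : AnalyticAt ℝ f 0) (hf0 : f 0 = 0)
    (h : ∀ᶠ t in 𝓝 0, α * (t * deriv f t) = 1 - (1 - f t) ^ α) (k : ℕ) :
    coeff k (taylorSeries f 0) = profileSigma α k * deriv f 0 ^ k := by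
  have second_order : (fun t => t * deriv (deriv f) t) =ᶠ[𝓝 0] fun t =>
      deriv (fun t => t * deriv f t) t * f t - α * (t * (deriv f t * deriv f t)) := by
    filter_upwards [hf.eventually_analyticAt, hf.continuousAt.eventually_lt_const (hf0 ▸ one_pos),
      h.eventually_nhds] with t hft hft1 ht using mul_deriv_deriv_of_first_order hα hft hft1 ht
  have hid : ContDiffAt ℝ ∞ (fun t : ℝ => t) 0 := contDiffAt_id
  have hd : ContDiffAt ℝ ∞ (deriv f) 0 := hf.deriv.contDiffAt
  have hdd : ContDiffAt ℝ ∞ (deriv (deriv f)) 0 := hf.deriv.deriv.contDiffAt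
  have hmul : ContDiffAt ℝ ∞ (deriv fun t => t * deriv f t) 0 :=
    (analyticAt_id.fun_mul hf.deriv).deriv.contDiffAt
  have hseries := taylorSeries_congr second_order
  rw [taylorSeries_sub (hmul.mul hf.contDiffAt) (contDiffAt_const.mul (hid.mul (hd.mul hd))),
    taylorSeries_const_mul, taylorSeries_mul hid hdd, taylorSeries_mul hmul hf.contDiffAt,
    taylorSeries_mul hid (hd.mul hd), taylorSeries_mul hd hd, taylorSeries_deriv,
    taylorSeries_deriv, taylorSeries_deriv, taylorSeries_mul hid hd, taylorSeries_deriv,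
    taylorSeries_id] at hseries
  have h0 : constantCoeff (taylorSeries f 0) = 0 := by
    rw [← coeff_zero_eq_constantCoeff_apply, coeff_taylorSeries, iteratedDeriv_zero, hf0, zero_div]
  rw [coeff_eq_profileSigma_mul_pow h0 hseries, coeff_taylorSeries, iteratedDeriv_one,
    Nat.factorial_one, Nat.cast_one, div_one]

end FirstOrderEquation

section Inverse

theorem continuousAt_invFun {X Y : Type*} [TopologicalSpace X] [TopologicalSpace Y] [Nonempty X]
    {f : X → Y} (hf : IsOpenEmbedding f) (x : X) : ContinuousAt (invFun f) (f x) := by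
  rw [← hf.continuousAt_iff, invFun_comp hf.injective]
  exact continuousAt_id

variable {𝕜 : Type*} [NontriviallyNormedField 𝕜] {f : 𝕜 → 𝕜} {x : 𝕜}

theorem hasDerivAt_invFun {f' : 𝕜} (hf : IsOpenEmbedding f) (hfx : HasDerivAt f f' x)
    (hf' : f' ≠ 0) : HasDerivAt (invFun f) f'⁻¹ (f x) := by
  rw [← leftInverse_invFun hf.injective x] at hfx
  refine hfx.of_local_left_inverse (continuousAt_invFun hf x) hf' ?_
  filter_upwards [hf.isOpen_range.mem_nhds (mem_range_self x)] with y hy using invFun_eq hy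

variable [CompleteSpace 𝕜]

theorem isOpenEmbedding_of_hasStrictDerivAt {f' : 𝕜 → 𝕜} (hf : ∀ x, HasStrictDerivAt f (f' x) x)
    (hf' : ∀ x, f' x ≠ 0) (hinj : Injective f) : IsOpenEmbedding f :=
  .of_continuous_injective_isOpenMap
    (continuous_iff_continuousAt.2 fun x => (hf x).hasDerivAt.continuousAt) hinj
    (isOpenMap_of_hasStrictDerivAt hf hf')

theorem analyticAt_invFun [CharZero 𝕜] (hf : AnalyticAt 𝕜 f x) (hf' : deriv f x ≠ 0)
    (hinj : Injective f) : AnalyticAt 𝕜 (invFun f) (f x) := by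
  rw [← analyticAt_comp_iff_of_deriv_ne_zero hf hf', invFun_comp hinj]
  exact analyticAt_id

end Inverse

section RpowSlope

variable {p x w : ℝ}

theorem analyticAt_rpow_const (hx : x ≠ 0) (p : ℝ) : AnalyticAt ℝ (fun y : ℝ => y ^ p) x :=
  (Real.contDiffAt_rpow_const_of_ne (n := ⊤) hx).analyticAt

/-- The quotient `(1 - x ^ p) / (1 - x)`, with its limit `p` as the value at `x = 1`; the
integrand of `γ_α` without its removable singularity is `rpowSlope ((1 - α) / α)`. -/
noncomputable def rpowSlope (p : ℝ) : ℝ → ℝ :=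
  dslope (fun x : ℝ => x ^ p) 1

theorem one_sub_mul_rpowSlope (p x : ℝ) : (1 - x) * rpowSlope p x = 1 - x ^ p := by
  have h := sub_smul_dslope (fun x : ℝ => x ^ p) 1 x
  rw [smul_eq_mul, Real.one_rpow] at h
  rw [rpowSlope]
  linarith

theorem rpowSlope_of_ne (p : ℝ) (hx : x ≠ 1) : rpowSlope p x = (1 - x ^ p) / (1 - x) := by
  rw [← one_sub_mul_rpowSlope, mul_div_cancel_left₀ _ (sub_ne_zero.2 hx.symm)]

theorem analyticAt_rpowSlope (p : ℝ) (hx : 0 < x) : AnalyticAt ℝ (rpowSlope p) x := by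
  rcases eq_or_ne x 1 with rfl | hx1
  · obtain ⟨q, hq⟩ := analyticAt_rpow_const one_ne_zero p
    exact ⟨_, hq.has_fpower_series_dslope_fslope⟩
  · have h : AnalyticAt ℝ (fun x : ℝ => (1 - x ^ p) / (1 - x)) x :=
      (analyticAt_const.sub (analyticAt_rpow_const hx.ne' p)).div
        (analyticAt_const.sub analyticAt_id) (sub_ne_zero.2 hx1.symm)
    refine h.congr ?_
    filter_upwards [isOpen_ne.mem_nhds hx1] with y hy using (rpowSlope_of_ne p hy).symm

theorem continuousOn_rpowSlope (p : ℝ) : ContinuousOn (rpowSlope p) (Ioi 0) := fun _ hx =>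
  (analyticAt_rpowSlope p hx).continuousAt.continuousWithinAt

theorem rpowSlope_nonneg (hp : 0 ≤ p) (hx : 0 ≤ x) : 0 ≤ rpowSlope p x := by
  rcases eq_or_ne x 1 with rfl | hx1
  · rw [rpowSlope, dslope_same, (Real.hasDerivAt_rpow_const (Or.inl one_ne_zero)).deriv]
    simpa using hp
  · rw [rpowSlope, dslope_of_ne _ hx1]
    exact (Real.monotoneOn_rpow_Ici_of_exponent_nonneg hp).slope_nonneg
      (mem_Ici.2 zero_le_one) (mem_Ici.2 hx)

theorem intervalIntegrable_rpowSlope (hp : -1 < p) (hw : 0 ≤ w) :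
    IntervalIntegrable (rpowSlope p) volume 0 w := by
  have near_zero : IntervalIntegrable (rpowSlope p) volume 0 (1 / 2) := by
    have h : IntervalIntegrable (fun x : ℝ => (1 - x ^ p) * (1 - x)⁻¹) volume 0 (1 / 2) := by
      refine ((intervalIntegrable_const (c := (1 : ℝ))).sub
        (intervalIntegral.intervalIntegrable_rpow' hp)).mul_continuousOn ?_
      refine ContinuousOn.inv₀ (by fun_prop) fun x hx => ?_
      rw [uIcc_of_le (by norm_num)] at hx
      linarith [hx.2]
    refine h.congr fun x hx => ?_
    rw [uIoc_of_le (by norm_num)] at hx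
    rw [rpowSlope_of_ne p (by linarith [hx.2]), div_eq_mul_inv]
  rcases hw.eq_or_lt with rfl | hw
  · exact IntervalIntegrable.refl
  · refine near_zero.trans (((continuousOn_rpowSlope p).mono fun x hx => ?_).intervalIntegrable)
    exact (lt_min one_half_pos hw).trans_le hx.1

/-- The primitive of `rpowSlope p` vanishing at `0`; for `p > -1` the integral converges. -/
noncomputable def rpowSlopePrimitive (p w : ℝ) : ℝ :=
  ∫ x in (0 : ℝ)..w, rpowSlope p x

theorem rpowSlopePrimitive_zero (p : ℝ) : rpowSlopePrimitive p 0 = 0 :=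
  intervalIntegral.integral_same

theorem hasDerivAt_rpowSlopePrimitive (hp : -1 < p) (hw : 0 < w) :
    HasDerivAt (rpowSlopePrimitive p) (rpowSlope p w) w :=
  intervalIntegral.integral_hasDerivAt_right (intervalIntegrable_rpowSlope hp hw.le)
    ((continuousOn_rpowSlope p).stronglyMeasurableAtFilter isOpen_Ioi w hw)
    (analyticAt_rpowSlope p hw).continuousAt

theorem analyticAt_rpowSlopePrimitive (hp : -1 < p) (hw : 0 < w) :
    AnalyticAt ℝ (rpowSlopePrimitive p) w :=
  analyticAt_of_hasDerivAt
    ((lt_mem_nhds hw).mono fun _ hy => hasDerivAt_rpowSlopePrimitive hp hy)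
    (analyticAt_rpowSlope p hw)

theorem continuousOn_rpowSlopePrimitive (hp : -1 < p) :
    ContinuousOn (rpowSlopePrimitive p) (Ici 0) := by
  intro w hw
  have hw1 : 0 ≤ w + 1 := add_nonneg hw zero_le_one
  have h := intervalIntegral.continuousOn_primitive_interval'
    (intervalIntegrable_rpowSlope hp hw1) left_mem_uIcc
  rw [uIcc_of_le hw1] at h
  refine (h w ⟨hw, (lt_add_one w).le⟩).mono_of_mem_nhdsWithin ?_
  filter_upwards [self_mem_nhdsWithin, mem_nhdsWithin_of_mem_nhds (Iic_mem_nhds (lt_add_one w))]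
    with y hy0 hy1 using ⟨hy0, hy1⟩

theorem monotoneOn_rpowSlopePrimitive (hp : 0 ≤ p) :
    MonotoneOn (rpowSlopePrimitive p) (Ici 0) := by
  have hp1 : -1 < p := by linarith
  refine monotoneOn_of_hasDerivWithinAt_nonneg (f' := rpowSlope p) (convex_Ici 0)
    (continuousOn_rpowSlopePrimitive hp1) ?_ ?_ <;> rw [interior_Ici] <;> intro w hw
  · exact (hasDerivAt_rpowSlopePrimitive hp1 hw).hasDerivWithinAt
  · exact rpowSlope_nonneg hp (le_of_lt hw)

end RpowSlope

section Gamma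

variable {α : ℝ}

theorem neg_one_lt_one_sub_div_self (hα : 0 < α) : -1 < (1 - α) / α := by
  rw [lt_div_iff₀ hα]
  linarith

theorem rpowSlope_ae_eq_gammaIntegrand (α : ℝ) :
    rpowSlope ((1 - α) / α) =ᵐ[volume] gammaIntegrand α := by
  filter_upwards [Measure.ae_ne volume (1 : ℝ)] with x hx using rpowSlope_of_ne _ hx

theorem intervalIntegrable_gammaIntegrand (hα : 0 < α) :
    IntervalIntegrable (gammaIntegrand α) volume 0 1 :=
  (intervalIntegrable_rpowSlope (neg_one_lt_one_sub_div_self hα) zero_le_one).congr_ae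
    (ae_restrict_of_ae (rpowSlope_ae_eq_gammaIntegrand α))

theorem profileGamma_eq (α : ℝ) :
    profileGamma α = (α * Real.exp (rpowSlopePrimitive ((1 - α) / α) 1))⁻¹ := by
  rw [profileGamma, rpowSlopePrimitive, intervalIntegral.integral_congr_ae_restrict
    (ae_restrict_of_ae (rpowSlope_ae_eq_gammaIntegrand α)), Real.exp_neg, mul_inv, one_div]

theorem profileGamma_pos (hα : 0 < α) : 0 < profileGamma α :=
  mul_pos (one_div_pos.2 hα) (Real.exp_pos _)

end Gamma

section Density

variable {α u : ℝ}

/-- The factor by which `phiInverse α` differs from its algebraic part, see `phiInverse_eq`, as a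
function of the value `u` of the profile. Negative `u` never occur as values; the truncation gives
the function the value `1` there, which makes `phiInverse α` differentiable on all of `ℝ`. -/
noncomputable def profileDensity (α u : ℝ) : ℝ :=
  Real.exp (rpowSlopePrimitive ((1 - α) / α) (max u 0 ^ α))

theorem profileDensity_pos (α u : ℝ) : 0 < profileDensity α u :=
  Real.exp_pos _

theorem profileDensity_of_nonpos (hα : α ≠ 0) (hu : u ≤ 0) : profileDensity α u = 1 := by
  rw [profileDensity, max_eq_right hu, Real.zero_rpow hα, rpowSlopePrimitive_zero, Real.exp_zero]

theorem profileDensity_of_nonneg (α : ℝ) (hu : 0 ≤ u) :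
    profileDensity α u = Real.exp (rpowSlopePrimitive ((1 - α) / α) (u ^ α)) := by
  rw [profileDensity, max_eq_left hu]

theorem profileDensity_eventuallyEq (α : ℝ) (hu : 0 < u) :
    profileDensity α =ᶠ[𝓝 u] fun v => Real.exp (rpowSlopePrimitive ((1 - α) / α) (v ^ α)) := by
  filter_upwards [lt_mem_nhds hu] with v hv using profileDensity_of_nonneg α hv.le

theorem continuous_profileDensity (hα : 0 < α) : Continuous (profileDensity α) := by
  refine Real.continuous_exp.comp ((continuousOn_rpowSlopePrimitive
    (neg_one_lt_one_sub_div_self hα)).comp_continuous ?_ fun u => ?_)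
  · exact (continuous_id.max continuous_const).rpow_const fun _ => Or.inr hα.le
  · exact Real.rpow_nonneg (le_max_right u 0) α

theorem analyticAt_profileDensity (hα : 0 < α) (hu : 0 < u) :
    AnalyticAt ℝ (profileDensity α) u := by
  have h := (analyticAt_rpowSlopePrimitive (neg_one_lt_one_sub_div_self hα)
    (Real.rpow_pos_of_pos hu α)).fun_comp (f := fun v : ℝ => v ^ α)
      (analyticAt_rpow_const hu.ne' α)
  exact h.rexp.congr (profileDensity_eventuallyEq α hu).symm

theorem hasDerivAt_profileDensity (hα : 0 < α) (hu : 0 < u) :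
    HasDerivAt (profileDensity α)
      (profileDensity α u * (rpowSlope ((1 - α) / α) (u ^ α) * (α * u ^ (α - 1)))) u := by
  have h := ((hasDerivAt_rpowSlopePrimitive (neg_one_lt_one_sub_div_self hα)
    (Real.rpow_pos_of_pos hu α)).comp u (Real.hasDerivAt_rpow_const (Or.inl hu.ne'))).exp
  rw [comp_apply, ← profileDensity_of_nonneg α hu.le] at h
  exact h.congr_of_eventuallyEq (profileDensity_eventuallyEq α hu)

theorem monotone_profileDensity (hα : 0 ≤ α) (hα1 : α ≤ 1) : Monotone (profileDensity α) :=
  fun u v huv => Real.exp_le_exp.2 <|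
    monotoneOn_rpowSlopePrimitive (div_nonneg (sub_nonneg.2 hα1) hα)
      (Real.rpow_nonneg (le_max_right u 0) α) (Real.rpow_nonneg (le_max_right v 0) α)
      (Real.rpow_le_rpow (le_max_right u 0) (max_le_max_right 0 huv) hα)

end Density

section PhiInverse

variable {α y t : ℝ}

/-- The inverse function of `φ`, defined as the solution of `S' = α * profileDensity α (1 - y)`,
`S 0 = 0`. It extends the inverse of `φ` to all of `ℝ`, but is analytic on `(-∞, 1)` only. -/
noncomputable def phiInverse (α y : ℝ) : ℝ :=
  ∫ z in (0 : ℝ)..y, α * profileDensity α (1 - z)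

theorem phiInverse_zero (α : ℝ) : phiInverse α 0 = 0 :=
  intervalIntegral.integral_same

theorem hasStrictDerivAt_phiInverse (hα : 0 < α) (y : ℝ) :
    HasStrictDerivAt (phiInverse α) (α * profileDensity α (1 - y)) y :=
  (((continuous_profileDensity hα).comp (continuous_sub_left 1)).const_mul
    α).integral_hasStrictDerivAt 0 y

theorem hasDerivAt_phiInverse (hα : 0 < α) (y : ℝ) :
    HasDerivAt (phiInverse α) (α * profileDensity α (1 - y)) y :=
  (hasStrictDerivAt_phiInverse hα y).hasDerivAt

theorem continuous_phiInverse (hα : 0 < α) : Continuous (phiInverse α) :=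
  continuous_iff_continuousAt.2 fun y => (hasDerivAt_phiInverse hα y).continuousAt

theorem strictMono_phiInverse (hα : 0 < α) : StrictMono (phiInverse α) :=
  strictMono_of_hasDerivAt_pos (hasDerivAt_phiInverse hα) fun _ =>
    mul_pos hα (profileDensity_pos α _)

theorem isOpenEmbedding_phiInverse (hα : 0 < α) : IsOpenEmbedding (phiInverse α) :=
  isOpenEmbedding_of_hasStrictDerivAt (hasStrictDerivAt_phiInverse hα)
    (fun _ => (mul_pos hα (profileDensity_pos α _)).ne') (strictMono_phiInverse hα).injective

theorem analyticAt_phiInverse (hα : 0 < α) (hy : y < 1) : AnalyticAt ℝ (phiInverse α) y := by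
  refine analyticAt_of_hasDerivAt (Eventually.of_forall (hasDerivAt_phiInverse hα))
    (analyticAt_const.mul ?_)
  exact (analyticAt_profileDensity hα (sub_pos.2 hy)).fun_comp (f := fun z : ℝ => 1 - z)
    (analyticAt_const.sub analyticAt_id)

theorem hasDerivAt_one_sub_rpow_mul_profileDensity (hα : 0 < α) (hy : y < 1) :
    HasDerivAt (fun y => (1 - (1 - y) ^ α) * profileDensity α (1 - y))
      (α * profileDensity α (1 - y)) y := by
  have hu : 0 < 1 - y := sub_pos.2 hy
  have h : HasDerivAt (fun u => (1 - u ^ α) * profileDensity α u)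
      (-(α * profileDensity α (1 - y))) (1 - y) := by
    refine (((Real.hasDerivAt_rpow_const (Or.inl hu.ne')).const_sub 1).mul
      (hasDerivAt_profileDensity hα hu)).congr_deriv ?_
    have h_slope := one_sub_mul_rpowSlope ((1 - α) / α) ((1 - y) ^ α)
    have h_cancel : ((1 - y) ^ α) ^ ((1 - α) / α) * (1 - y) ^ (α - 1) = 1 := by
      rw [← Real.rpow_mul hu.le, ← Real.rpow_add hu, mul_div_cancel₀ _ hα.ne',
        sub_add_sub_cancel, sub_self, Real.rpow_zero]
    linear_combination profileDensity α (1 - y) * α * (1 - y) ^ (α - 1) * h_slope -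
      profileDensity α (1 - y) * α * h_cancel
  simpa using h.comp_const_sub 1 y

theorem phiInverse_eq (hα : 0 < α) (hy : y ≤ 1) :
    phiInverse α y = (1 - (1 - y) ^ α) * profileDensity α (1 - y) := by
  have eqOn_Iio : EqOn (phiInverse α) (fun y => (1 - (1 - y) ^ α) * profileDensity α (1 - y))
      (Iio 1) := by
    have hd := fun y (hy : y < 1) => hasDerivAt_one_sub_rpow_mul_profileDensity hα hy
    refine isOpen_Iio.eqOn_of_deriv_eq isPreconnected_Iio
      (fun y _ => (hasDerivAt_phiInverse hα y).differentiableAt.differentiableWithinAt)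
      (fun y hy => (hd y hy).differentiableAt.differentiableWithinAt)
      (fun y hy => ?_) (mem_Iio.2 one_pos) (by simp [phiInverse_zero])
    rw [(hd y hy).deriv, (hasDerivAt_phiInverse hα y).deriv]
  have hcont : Continuous fun y => (1 - (1 - y) ^ α) * profileDensity α (1 - y) :=
    (continuous_const.sub ((continuous_sub_left 1).rpow_const fun _ => Or.inr hα.le)).mul
      ((continuous_profileDensity hα).comp (continuous_sub_left 1))
  have h := eqOn_Iio.closure (continuous_phiInverse hα) hcont
  rw [closure_Iio] at h
  exact h hy

theorem phiInverse_one (hα : 0 < α) : phiInverse α 1 = 1 := by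
  rw [phiInverse_eq hα le_rfl, sub_self, profileDensity_of_nonpos hα.ne' le_rfl,
    Real.zero_rpow hα.ne', sub_zero, mul_one]

/-- The interval of those `t` at which `phiInverse α y = t` has a solution `y < 1`. The function
`φ` is continued to this interval. -/
def phiDomain (α : ℝ) : Set ℝ :=
  phiInverse α '' Iio 1

theorem isOpen_phiDomain (hα : 0 < α) : IsOpen (phiDomain α) :=
  (isOpenEmbedding_phiInverse hα).isOpenMap _ isOpen_Iio

theorem ordConnected_phiDomain (hα : 0 < α) : (phiDomain α).OrdConnected :=
  (isPreconnected_Iio.image _ (continuous_phiInverse hα).continuousOn).ordConnected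

theorem Ico_phiInverse_one_subset_phiDomain (hα : 0 < α) (hy : y ≤ 1) :
    Ico (phiInverse α y) 1 ⊆ phiDomain α := by
  have h := intermediate_value_Ico hy (continuous_phiInverse hα).continuousOn
  rw [phiInverse_one hα] at h
  exact h.trans (image_mono Ico_subset_Iio_self)

theorem Ico_zero_one_subset_phiDomain (hα : 0 < α) : Ico 0 1 ⊆ phiDomain α := by
  simpa only [phiInverse_zero] using Ico_phiInverse_one_subset_phiDomain hα zero_le_one

theorem phiDomain_subset_Iio (hα : 0 < α) : phiDomain α ⊆ Iio 1 := by
  rintro _ ⟨y, hy, rfl⟩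
  rw [mem_Iio, ← phiInverse_one hα]
  exact strictMono_phiInverse hα hy

theorem zero_mem_phiDomain (α : ℝ) : 0 ∈ phiDomain α :=
  ⟨0, mem_Iio.2 one_pos, phiInverse_zero α⟩

theorem phiDomain_mem_nhds_zero (hα : 0 < α) : phiDomain α ∈ 𝓝 0 :=
  (isOpen_phiDomain hα).mem_nhds (zero_mem_phiDomain α)

theorem exists_Ioo_subset_phiDomain (hα : 0 < α) : ∃ ε > 0, Ioo (-ε) 1 ⊆ phiDomain α := by
  obtain ⟨a, ha, h⟩ := exists_Ioc_subset_of_mem_nhds (phiDomain_mem_nhds_zero hα) (exists_lt 0)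
  refine ⟨-a, neg_pos.2 ha, fun t ht => ?_⟩
  rcases le_or_gt t 0 with ht0 | ht0
  · exact h ⟨by simpa using ht.1, ht0⟩
  · exact Ico_zero_one_subset_phiDomain hα ⟨ht0.le, ht.2⟩

/-- For `t ≤ 0`, the point `1 - (1 - t) ^ α⁻¹` is mapped below `t` since the density is at
least `1`. -/
theorem phiDomain_eq_Iio (hα : 0 < α) (hα1 : α ≤ 1) : phiDomain α = Iio 1 := by
  refine (phiDomain_subset_Iio hα).antisymm fun t ht => ?_
  rcases le_or_gt 0 t with ht0 | ht0
  · exact Ico_zero_one_subset_phiDomain hα ⟨ht0, ht⟩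
  have hu : 0 ≤ (1 - t) ^ α⁻¹ := Real.rpow_nonneg (sub_nonneg.2 (le_of_lt ht)) _
  have hle : 1 - (1 - t) ^ α⁻¹ ≤ 1 := sub_le_self 1 hu
  refine Ico_phiInverse_one_subset_phiDomain hα hle ⟨?_, ht⟩
  rw [phiInverse_eq hα hle, sub_sub_cancel,
    Real.rpow_inv_rpow (sub_nonneg.2 (le_of_lt ht)) hα.ne', sub_sub_cancel]
  have one_le := monotone_profileDensity hα.le hα1 hu
  rw [profileDensity_of_nonpos hα.ne' le_rfl] at one_le
  exact (mul_le_mul_of_nonpos_left one_le ht0.le).trans_eq (mul_one t)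

end PhiInverse

section PhiExtension

variable {α t : ℝ}

/-- The continuation of `φ`: the inverse function of `phiInverse α`. It is analytic on
`phiDomain α`; outside the range of `phiInverse α` its values are meaningless. -/
noncomputable def phiExtension (α : ℝ) : ℝ → ℝ :=
  invFun (phiInverse α)

theorem phiExtension_phiInverse (hα : 0 < α) (y : ℝ) : phiExtension α (phiInverse α y) = y :=
  leftInverse_invFun (strictMono_phiInverse hα).injective y

theorem phiExtension_zero (hα : 0 < α) : phiExtension α 0 = 0 := by
  simpa only [phiInverse_zero] using phiExtension_phiInverse hα 0

theorem phiExtension_one (hα : 0 < α) : phiExtension α 1 = 1 := by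
  simpa only [phiInverse_one hα] using phiExtension_phiInverse hα 1

theorem hasDerivAt_phiExtension (hα : 0 < α) (y : ℝ) :
    HasDerivAt (phiExtension α) (α * profileDensity α (1 - y))⁻¹ (phiInverse α y) :=
  hasDerivAt_invFun (isOpenEmbedding_phiInverse hα) (hasDerivAt_phiInverse hα y)
    (mul_pos hα (profileDensity_pos α _)).ne'

theorem differentiableAt_phiExtension (hα : 0 < α) (ht : t ∈ range (phiInverse α)) :
    DifferentiableAt ℝ (phiExtension α) t := by
  obtain ⟨y, rfl⟩ := ht
  exact (hasDerivAt_phiExtension hα y).differentiableAt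

theorem analyticOnNhd_phiExtension (hα : 0 < α) :
    AnalyticOnNhd ℝ (phiExtension α) (phiDomain α) := by
  rintro _ ⟨y, hy, rfl⟩
  refine analyticAt_invFun (analyticAt_phiInverse hα hy) ?_ (strictMono_phiInverse hα).injective
  rw [(hasDerivAt_phiInverse hα y).deriv]
  exact (mul_pos hα (profileDensity_pos α _)).ne'

theorem deriv_phiExtension_zero (hα : 0 < α) : deriv (phiExtension α) 0 = profileGamma α := by
  have h := (hasDerivAt_phiExtension hα 0).deriv
  rwa [phiInverse_zero, sub_zero, profileDensity_of_nonneg α zero_le_one, Real.one_rpow,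
    ← profileGamma_eq] at h

theorem mul_deriv_phiExtension (hα : 0 < α) (ht : t ∈ phiInverse α '' Iic 1) :
    α * (t * deriv (phiExtension α) t) = 1 - (1 - phiExtension α t) ^ α := by
  obtain ⟨y, hy, rfl⟩ := ht
  have := profileDensity_pos α (1 - y)
  rw [(hasDerivAt_phiExtension hα y).deriv, phiExtension_phiInverse hα, phiInverse_eq hα hy]
  field_simp

theorem strictMonoOn_phiExtension (hα : 0 < α) : StrictMonoOn (phiExtension α) (phiDomain α) := by
  rintro _ ⟨y, -, rfl⟩ _ ⟨z, -, rfl⟩ h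
  rw [phiExtension_phiInverse hα, phiExtension_phiInverse hα]
  exact (strictMono_phiInverse hα).lt_iff_lt.1 h

theorem monotoneOn_deriv_phiExtension (hα : 0 < α) (hα1 : α ≤ 1) :
    MonotoneOn (deriv (phiExtension α)) (phiDomain α) := by
  rintro _ ⟨y, -, rfl⟩ _ ⟨z, -, rfl⟩ h
  have hyz : y ≤ z := (strictMono_phiInverse hα).le_iff_le.1 h
  rw [(hasDerivAt_phiExtension hα y).deriv, (hasDerivAt_phiExtension hα z).deriv]
  refine inv_anti₀ (mul_pos hα (profileDensity_pos α _)) (mul_le_mul_of_nonneg_left ?_ hα.le)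
  exact monotone_profileDensity hα.le hα1 (sub_le_sub_left hyz 1)

theorem convexOn_phiExtension (hα : 0 < α) (hα1 : α ≤ 1) :
    ConvexOn ℝ (phiDomain α) (phiExtension α) := by
  have hd := (analyticOnNhd_phiExtension hα).differentiableOn
  have hint := (isOpen_phiDomain hα).interior_eq
  refine MonotoneOn.convexOn_of_deriv (ordConnected_phiDomain hα).convex hd.continuousOn ?_ ?_ <;>
    rw [hint]
  exacts [hd, monotoneOn_deriv_phiExtension hα hα1]

theorem coeff_taylorSeries_phiExtension (hα : 0 < α) (k : ℕ) :
    coeff k (taylorSeries (phiExtension α) 0) = profileSigma α k * profileGamma α ^ k := by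
  rw [← deriv_phiExtension_zero hα]
  refine coeff_taylorSeries_of_first_order hα.ne' (analyticOnNhd_phiExtension hα 0
    (zero_mem_phiDomain α)) (phiExtension_zero hα) ?_ k
  filter_upwards [phiDomain_mem_nhds_zero hα] with t ht
    using mul_deriv_phiExtension hα (image_mono Iio_subset_Iic_self ht)

/-- The power series `∑ σ_k (γ_α t) ^ k` at `t = 0`, which turns out to represent `φ`. -/
noncomputable def phiSeries (α : ℝ) : FormalMultilinearSeries ℝ ℝ ℝ :=
  .ofScalars ℝ fun k => profileSigma α k * profileGamma α ^ k

theorem hasSum_phiSeries_iff {s : ℝ} :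
    HasSum (fun k => phiSeries α k fun _ => t) s ↔
      HasSum (fun k : ℕ => profileSigma α (k + 1) * (profileGamma α * t) ^ (k + 1)) s := by
  rw [← hasSum_nat_add_iff' 1]
  simp only [phiSeries, FormalMultilinearSeries.ofScalars_apply_eq, smul_eq_mul,
    Finset.sum_range_one, profileSigma, zero_mul, sub_zero, mul_pow, mul_assoc]

theorem exists_hasSum_of_hasFPowerSeriesAt {g : ℝ → ℝ} (hg : HasFPowerSeriesAt g (phiSeries α) 0) :
    ∃ r > 0, ∀ t, |t| < r →
      HasSum (fun k : ℕ => profileSigma α (k + 1) * (profileGamma α * t) ^ (k + 1)) (g t) := by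
  simpa only [zero_add, hasSum_phiSeries_iff, Real.dist_0_eq_abs] using
    Metric.eventually_nhds_iff.1 hg.eventually_hasSum

theorem iteratedDeriv_phiExtension_div_factorial (hα : 0 < α) :
    (fun n : ℕ => iteratedDeriv n (phiExtension α) 0 / n !) =
      fun n => profileSigma α n * profileGamma α ^ n := by
  simp only [← coeff_taylorSeries, coeff_taylorSeries_phiExtension hα]

theorem hasFPowerSeriesAt_phiExtension (hα : 0 < α) :
    HasFPowerSeriesAt (phiExtension α) (phiSeries α) 0 := by
  rw [phiSeries, ← iteratedDeriv_phiExtension_div_factorial hα]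
  exact (analyticOnNhd_phiExtension hα 0 (zero_mem_phiDomain α)).hasFPowerSeriesAt

theorem iteratedDeriv_phiExtension_zero_nonneg (hα : 0 < α) (hα1 : α < 1) (n : ℕ) :
    0 ≤ iteratedDeriv n (phiExtension α) 0 := by
  have h := congrFun (iteratedDeriv_phiExtension_div_factorial hα) n
  rw [div_eq_iff (by positivity)] at h
  rw [h]
  have := profileSigma_nonneg hα.le hα1 n
  have := profileGamma_pos hα
  positivity

theorem hasFPowerSeriesOnBall_phiExtension (hα : 0 < α) (hα1 : α < 1) :
    HasFPowerSeriesOnBall (phiExtension α) (phiSeries α) 0 1 := by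
  rw [phiSeries, ← iteratedDeriv_phiExtension_div_factorial hα, ← ENNReal.ofReal_one]
  refine hasFPowerSeriesOnBall_of_iteratedDeriv_nonneg one_pos
    ((analyticOnNhd_phiExtension hα).mono ?_) (iteratedDeriv_phiExtension_zero_nonneg hα hα1)
  rw [phiDomain_eq_Iio hα hα1.le, Real.ball_eq_Ioo, zero_add]
  exact Ioo_subset_Iio_self

theorem hasSum_phiExtension (hα : 0 < α) (hα1 : α < 1) (ht : t ∈ Ioo (-1) 1) :
    HasSum (fun k : ℕ => profileSigma α (k + 1) * (profileGamma α * t) ^ (k + 1))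
      (phiExtension α t) := by
  have h := (hasFPowerSeriesOnBall_phiExtension hα hα1).hasSum (y := t) ?_
  · rwa [zero_add, hasSum_phiSeries_iff] at h
  · rw [← ENNReal.ofReal_one, Metric.eball_ofReal, Real.ball_eq_Ioo]
    simpa using ht

end PhiExtension

section Profile

variable {α : ℝ}

theorem exists_isProfile (hα : 0 < α) : ∃ F, IsProfile α F := by
  refine ⟨fun x => 1 - phiExtension α (Real.exp (-α * x)), ?_, fun x hx => ?_⟩
  · simp only [mul_zero, Real.exp_zero, phiExtension_one hα, sub_self]
  have h_mem : Real.exp (-α * x) ∈ phiInverse α '' Iic 1 := by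
    have h := intermediate_value_Ioc zero_le_one (continuous_phiInverse hα).continuousOn
    rw [phiInverse_zero, phiInverse_one hα] at h
    refine image_mono (fun _ hy => hy.2) (h ⟨Real.exp_pos _, Real.exp_le_one_iff.2 ?_⟩)
    exact mul_nonpos_of_nonpos_of_nonneg (neg_nonpos.2 hα.le) hx
  have h_ode := mul_deriv_phiExtension hα h_mem
  have h_ext := (differentiableAt_phiExtension hα (image_subset_range _ _ h_mem)).hasDerivAt
  refine ((h_ext.comp x ((hasDerivAt_id' x).const_mul (-α)).exp).const_sub
    1).hasDerivWithinAt.congr_deriv ?_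
  beta_reduce
  rw [← h_ode]
  ring

namespace IsProfile

variable {F : ℝ → ℝ}

theorem continuousOn (hF : IsProfile α F) : ContinuousOn F (Ici 0) := fun x hx =>
  (hF.2 x hx).continuousWithinAt

theorem nonneg (hα : α ≠ 0) (hF : IsProfile α F) {x : ℝ} (hx : 0 ≤ x) : 0 ≤ F x := by
  refine neg_nonpos.1 (image_le_of_deriv_right_lt_deriv_boundary
    (B := fun _ => 0) (B' := fun _ => 0) (hF.continuousOn.mono Icc_subset_Ici_self).neg
    (fun y hy => ((hF.2 y hy.1).mono (Ici_subset_Ici.2 hy.1)).neg) (by simp [hF.1])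
    (fun y => hasDerivAt_const y 0) (fun y _ hy => ?_) (right_mem_Icc.2 hx))
  rw [neg_eq_zero.1 hy, Real.zero_rpow hα]
  norm_num

theorem phiInverse_one_sub (hα : 0 < α) (hF : IsProfile α F) {x : ℝ} (hx : 0 ≤ x) :
    phiInverse α (1 - F x) = Real.exp (-α * x) := by
  have hderiv : ∀ y ∈ Ico 0 x,
      HasDerivWithinAt (fun y => phiInverse α (1 - F y) * Real.exp (α * y)) 0 (Ici y) y := by
    intro y hy
    have hexp : HasDerivAt (fun y => Real.exp (α * y)) (Real.exp (α * y) * (α * 1)) y :=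
      ((hasDerivAt_id' y).const_mul α).exp
    have hFy := (hF.2 y hy.1).mono (Ici_subset_Ici.2 hy.1)
    refine (((hasDerivAt_phiInverse hα (1 - F y)).comp_hasDerivWithinAt y
      (hFy.const_sub 1)).mul hexp.hasDerivWithinAt).congr_deriv ?_
    rw [comp_apply, phiInverse_eq hα (sub_le_self 1 (hF.nonneg hα.ne' hy.1)), sub_sub_cancel]
    ring
  have hcont : ContinuousOn (fun y => phiInverse α (1 - F y) * Real.exp (α * y)) (Icc 0 x) :=
    ((continuous_phiInverse hα).comp_continuousOn
      (continuousOn_const.sub (hF.continuousOn.mono Icc_subset_Ici_self))).mul (by fun_prop)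
  have h := constant_of_has_deriv_right_zero hcont hderiv x (right_mem_Icc.2 hx)
  rw [hF.1, sub_zero, phiInverse_one hα, mul_zero, Real.exp_zero, mul_one] at h
  rw [neg_mul, Real.exp_neg]
  exact eq_inv_of_mul_eq_one_left h

theorem eq_one_sub_phiExtension (hα : 0 < α) (hF : IsProfile α F) {x : ℝ} (hx : 0 ≤ x) :
    F x = 1 - phiExtension α (Real.exp (-α * x)) := by
  rw [← hF.phiInverse_one_sub hα hx, phiExtension_phiInverse hα, sub_sub_cancel]

theorem eqOn (hα : 0 < α) {F₁ F₂ : ℝ → ℝ} (h₁ : IsProfile α F₁) (h₂ : IsProfile α F₂) :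
    EqOn F₁ F₂ (Ici 0) := fun _ hx =>
  (h₁.eq_one_sub_phiExtension hα hx).trans (h₂.eq_one_sub_phiExtension hα hx).symm

theorem eqOn_profilePhi (hα : 0 < α) (hF : IsProfile α F) :
    EqOn (phiExtension α) (profilePhi α F) (Ioo 0 1) := by
  intro t ht
  have hx : 0 ≤ -(1 / α) * Real.log t :=
    mul_nonneg_of_nonpos_of_nonpos (neg_nonpos.2 (one_div_pos.2 hα).le)
      (Real.log_nonpos ht.1.le ht.2.le)
  have hlog : -α * (-(1 / α) * Real.log t) = Real.log t := by field_simp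
  rw [profilePhi, hF.eq_one_sub_phiExtension hα hx, hlog, Real.exp_log ht.1, sub_sub_cancel]

end IsProfile

end Profile

section Continuation

variable {f g h : ℝ → ℝ} {U V : Set ℝ}

theorem IsAnalyticContinuation.mono (hg : IsAnalyticContinuation f U g) (hV : Ioo 0 1 ⊆ V)
    (hVU : V ⊆ U) : IsAnalyticContinuation f V g :=
  ⟨hV, hg.2.1.mono hVU, hg.2.2⟩

theorem IsAnalyticContinuation.eqOn_inter (hg : IsAnalyticContinuation f U g)
    (hh : IsAnalyticContinuation f V h) (hU : U.OrdConnected) (hV : V.OrdConnected) :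
    EqOn g h (U ∩ V) := by
  have h_half : (1 / 2 : ℝ) ∈ Ioo 0 1 := ⟨one_half_pos, one_half_lt_one⟩
  have h_near : g =ᶠ[𝓝 (1 / 2)] h := by
    filter_upwards [isOpen_Ioo.mem_nhds h_half] with t ht using (hg.2.2 ht).trans (hh.2.2 ht).symm
  exact (hg.2.1.mono inter_subset_left).eqOn_of_preconnected_of_eventuallyEq
    (hh.2.1.mono inter_subset_right) (hU.inter hV).isPreconnected ⟨hg.1 h_half, hh.1 h_half⟩ h_near

theorem IsProfile.isAnalyticContinuation_phiExtension {α : ℝ} {F : ℝ → ℝ} (hα : 0 < α)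
    (hF : IsProfile α F) :
    IsAnalyticContinuation (profilePhi α F) (phiDomain α) (phiExtension α) :=
  ⟨Ioo_subset_Ico_self.trans (Ico_zero_one_subset_phiDomain hα), analyticOnNhd_phiExtension hα,
    hF.eqOn_profilePhi hα⟩

end Continuation

theorem theorem4p5 (α : ℝ) (hα : 0 < α) :
    -- the defining problem is uniquely solvable and the integral in `γ_α` converges
    (∃ F, IsProfile α F) ∧
    (∀ F₁ F₂, IsProfile α F₁ → IsProfile α F₂ → EqOn F₁ F₂ (Ici 0)) ∧
    IntervalIntegrable (gammaIntegrand α) MeasureTheory.volume 0 1 ∧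
    ∀ F, IsProfile α F →
      -- (i) analytic continuation to `(-ε, 1)`
      (∃ ε > 0, ∃ g, IsAnalyticContinuation (profilePhi α F) (Ioo (-ε) 1) g) ∧
      -- (ii) Taylor series at `0` of the continuation
      (∀ ε > 0, ∀ g, IsAnalyticContinuation (profilePhi α F) (Ioo (-ε) 1) g →
        ∃ r > 0, ∀ t, |t| < r →
          HasSum (fun k : ℕ => profileSigma α (k + 1) * (profileGamma α * t) ^ (k + 1)) (g t)) ∧
      -- (iii) positivity of the coefficients and convergence on `(-1, 1)`
      (α < 1 →
        (∀ k, 1 ≤ k → 0 < profileSigma α k) ∧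
        (∀ t ∈ Ioo (-1 : ℝ) 1,
          Summable (fun k : ℕ => profileSigma α (k + 1) * (profileGamma α * t) ^ (k + 1))) ∧
        (∀ ε > 0, ∀ g, IsAnalyticContinuation (profilePhi α F) (Ioo (-ε) 1) g →
          ∀ t ∈ Ioo (-1 : ℝ) 1, -ε < t →
            HasSum (fun k : ℕ => profileSigma α (k + 1) * (profileGamma α * t) ^ (k + 1))
              (g t))) ∧
      -- (iv) continuation to `(-∞, 1)`, monotonicity and convexity
      (α < 1 →
        (∃ g, IsAnalyticContinuation (profilePhi α F) (Iio 1) g) ∧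
        (∀ g, IsAnalyticContinuation (profilePhi α F) (Iio 1) g →
          StrictMonoOn g (Iio 1) ∧ ConvexOn ℝ (Iio 1) g)) := by
  refine ⟨exists_isProfile hα, fun F₁ F₂ h₁ h₂ => h₁.eqOn hα h₂,
    intervalIntegrable_gammaIntegrand hα, fun F hF => ?_⟩
  have hφ := hF.isAnalyticContinuation_phiExtension hα
  have hD := ordConnected_phiDomain hα
  refine ⟨?_, fun ε hε g hg => ?_, fun hα1 => ⟨fun k => profileSigma_pos hα.le hα1, fun t ht =>
    (hasSum_phiExtension hα hα1 ht).summable, fun ε hε g hg t ht hεt => ?_⟩, fun hα1 => ?_⟩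
  · obtain ⟨ε, hε, hεD⟩ := exists_Ioo_subset_phiDomain hα
    exact ⟨ε, hε, _, hφ.mono (Ioo_subset_Ioo_left (neg_nonpos.2 hε.le)) hεD⟩
  · have h_nhds : Ioo (-ε) 1 ∩ phiDomain α ∈ 𝓝 0 :=
      inter_mem (Ioo_mem_nhds (neg_lt_zero.2 hε) one_pos) (phiDomain_mem_nhds_zero hα)
    exact exists_hasSum_of_hasFPowerSeriesAt ((hasFPowerSeriesAt_phiExtension hα).congr
      ((hφ.eqOn_inter hg hD ordConnected_Ioo).eventuallyEq_of_mem (inter_comm _ _ ▸ h_nhds)))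
  · rw [phiDomain_eq_Iio hα hα1.le] at hφ hD
    rw [hg.eqOn_inter hφ ordConnected_Ioo hD ⟨⟨hεt, ht.2⟩, ht.2⟩]
    exact hasSum_phiExtension hα hα1 ht
  · have h_mono := strictMonoOn_phiExtension hα
    have h_conv := convexOn_phiExtension hα hα1.le
    rw [phiDomain_eq_Iio hα hα1.le] at hφ hD h_mono h_conv
    refine ⟨⟨_, hφ⟩, fun g hg => ?_⟩
    have h_eq : EqOn (phiExtension α) g (Iio 1) := by
      simpa only [inter_self] using hφ.eqOn_inter hg hD hD
    exact ⟨h_mono.congr h_eq, h_conv.congr h_eq⟩
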